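/- **Setting.** For $s\in\mathbb N$, $s\ge 1$, and $\varepsilon\ge 0$ let $T_j$ be the Chebyshev polynomials of the first kind and put $$\omega_0=1+\frac{\varepsilon}{s^2},\quad \omega_1=\frac{T_s(\omega_0)}{T_s'(\omega_0)},\quad b_j=\frac1{T_j(\omega_0)},\quad \ell_s^{\varepsilon}=\frac{2\omega_0}{\omega_1},\quad R_s^{\varepsilon}(z)=b_sT_s(\omega_0+\omega_1z).$$ One step of size $\tau$ of the $s$-stage Runge–Kutta–Chebyshev (RKC) method with damping $\varepsilon$ for $y'=f(y)$ maps $y=k_0$ to $k_s$, where $k_1=k_0+\frac{\omega_1}{\omega_0}\tau f(k_0)$ and $k_j=\frac{2\omega_0b_j}{b_{j-1}}k_{j-1}-\frac{b_j}{b_{j-2}}k_{j-2}+\frac{2\omega_1b_j}{b_{j-1}}\tau f(k_{j-1})$ for $2\le j\le s$. For $m\geq 1$ let $\Phi_m^{\varepsilon}(z)=(R_m^{\varepsilon}(z)-1)/z$ for $z\ne0$ and $\Phi_m^{\varepsilon}(0)=1$. One step of the $(s,m)$-stage multirate RKC (mRKC) scheme for $y'=f_F(y)+f_S(y)$, with outer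 damping $\varepsilon$, inner damping $\varepsilon'$, step size $\tau>0$ and $\eta>0$, is one step of size $\tau$ of the $s$-stage RKC method with damping $\varepsilon$ for $y'=\overline f_\eta(y)$, where $\overline f_\eta(y)=\frac1\eta(u_\eta-y)$ and $u_\eta$ is the result of one step of size $\eta$, started at $y$, of the $m$-stage RKC method with damping $\varepsilon'$ for $u'=f_F(u)+f_S(y)$ ($y$ fixed). Its stability polynomial is $R_{s,m}(\lambda,\zeta,\tau,\eta)=R_s^{\varepsilon}\big(\tau\,\Phi_m^{\varepsilon'}(\eta\lambda)(\lambda+\zeta)\big)$. For $m\ge 2$ call $\overline\varepsilon_m>0$ *admissible* if for all $\varepsilon\in[0,\overline\varepsilon_m]$ and all $w\le0$: $$\Phi_m^{\varepsilon}(z)(z+w)\in[w,0]\ \text{ for all } z\in[-\ell_m^{\varepsilon},0]\iff (\Phi_m^{\varepsilon})'(0)\,|w|\ge1 .$$ **Theorem.** For every integer $m\ge2$ an admissible $\overline\varepsilon_m>0$ exists. Moreover, let $\overline\varepsilon_m$ be any admissible number, let $\varepsilon\ge0$ and $\varepsilon_m=\min\{\varepsilon,\overline\varepsilon_m\}$,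 and let $\lambda\le0$, $\zeta<0$. Then for all $\tau>0$, all integers $s\ge1$ and all $\eta$ with $$\tau|\zeta|\le\ell_s^{\varepsilon},\qquad \eta|\lambda|\le\ell_m^{\varepsilon_m},\qquad \eta\ge\frac{6\tau}{\ell_s^{\varepsilon}}\,\frac{m^2}{m^2-1},$$ the mRKC scheme with outer damping $\varepsilon$ and inner damping $\varepsilon_m$ is stable for the multirate test equation $y'=\lambda y+\zeta y$, $f_F(y)=\lambda y$, $f_S(y)=\zeta y$. That is, its stability polynomial satisfies $|R_{s,m}(\lambda,\zeta,\tau,\eta)|\le1$, and one step of the scheme maps every $y\in\mathbb R$ to a value of absolute value at most $|y|$. -/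

import Mathlib

namespace MRKC

noncomputable section

/-- The value `T_j(x)` of the Chebyshev polynomial of the first kind. -/
def chebT (j : ℕ) (x : ℝ) : ℝ := (Polynomial.Chebyshev.T ℝ (j : ℤ)).eval x

/-- The value `T_j'(x)` of the derivative of the Chebyshev polynomial of the first kind. -/
def chebT' (j : ℕ) (x : ℝ) : ℝ :=
  (Polynomial.derivative (Polynomial.Chebyshev.T ℝ (j : ℤ))).eval x

/-- `ω₀ = 1 + ε / s²`, for `s` stages and damping `ε`. -/
def omega0 (s : ℕ) (ε : ℝ) : ℝ := 1 + ε / (s : ℝ) ^ 2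

/-- `ω₁ = T_s(ω₀) / T_s'(ω₀)`. -/
def omega1 (s : ℕ) (ε : ℝ) : ℝ := chebT s (omega0 s ε) / chebT' s (omega0 s ε)

/-- `b_j = 1 / T_j(ω₀)`. -/
def coeffB (s : ℕ) (ε : ℝ) (j : ℕ) : ℝ := 1 / chebT j (omega0 s ε)

/-- The length `ℓ_s^ε = 2 ω₀ / ω₁` of the real stability interval. -/
def stabLength (s : ℕ) (ε : ℝ) : ℝ := 2 * omega0 s ε / omega1 s ε

/-- The stability polynomial of the `s`-stage Runge-Kutta-Chebyshev (RKC) method with damping `ε`: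
`z ↦ b_s T_s(ω₀ + ω₁ z)`. With `s` stages it is `R_s`, with `m` stages it is `P_m`. -/
def stabPoly (s : ℕ) (ε z : ℝ) : ℝ :=
  coeffB s ε s * chebT s (omega0 s ε + omega1 s ε * z)

/-- `Φ_m(z) = (P_m(z) - 1) / z` for `z ≠ 0`, and `Φ_m(0) = 1`. -/
def Phi (m : ℕ) (ε z : ℝ) : ℝ := if z = 0 then 1 else (stabPoly m ε z - 1) / z

/-- The stability polynomial `R_s(τ Φ_m(η lam) (lam + ζ))` of the `(s, m)`-stage multirate RKC
scheme, with outer damping `ε` and inner damping `εin`. -/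
def mrkcStabPoly (s m : ℕ) (ε εin lam ζ τ η : ℝ) : ℝ :=
  stabPoly s ε (τ * Phi m εin (η * lam) * (lam + ζ))

/-- The stages `k_0, k_1, …` of one step of size `τ` of the RKC method with `s` stages and
damping `ε`, for the equation `y' = f y`, started at `y`; the coefficients are
`μ₁ = ω₁ / ω₀` and, for `j ≥ 2`, `μ_j = 2 ω₁ b_j / b_{j-1}`, `ν_j = 2 ω₀ b_j / b_{j-1}`,
`κ_j = - b_j / b_{j-2}`. -/
def rkcStage (s : ℕ) (ε τ : ℝ) (f : ℝ → ℝ) (y : ℝ) : ℕ → ℝ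
  | 0 => y
  | 1 => y + omega1 s ε / omega0 s ε * τ * f y
  | j + 2 =>
      (2 * omega0 s ε * coeffB s ε (j + 2) / coeffB s ε (j + 1)) * rkcStage s ε τ f y (j + 1)
      + (-coeffB s ε (j + 2) / coeffB s ε j) * rkcStage s ε τ f y j
      + (2 * omega1 s ε * coeffB s ε (j + 2) / coeffB s ε (j + 1)) * τ *
          f (rkcStage s ε τ f y (j + 1))

/-- One step of size `τ` of the `s`-stage RKC method with damping `ε` for `y' = f y`. -/
def rkcStep (s : ℕ) (ε τ : ℝ) (f : ℝ → ℝ) (y : ℝ) : ℝ := rkcStage s ε τ f y s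

/-- The numerical averaged force `(u_η - y) / η`, where `u_η` is the result of one step of size `η`
of the `m`-stage RKC method with damping `εin` for `u' = fF u + fS y`, `u(0) = y`. -/
def averagedForce (m : ℕ) (εin η : ℝ) (fF fS : ℝ → ℝ) (y : ℝ) : ℝ :=
  1 / η * (rkcStep m εin η (fun u => fF u + fS y) y - y)

/-- One step of size `τ` of the `(s, m)`-stage multirate RKC scheme for `y' = fF y + fS y`. -/
def mrkcStep (s m : ℕ) (ε εin τ η : ℝ) (fF fS : ℝ → ℝ) (y : ℝ) : ℝ :=
  rkcStep s ε τ (averagedForce m εin η fF fS) y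

/-- `εbar` is an admissible bound on the inner damping for `m` stages: it is positive and, for
every damping `0 ≤ ε ≤ εbar` and every `w ≤ 0`, the inclusion `Φ_m(z) (z + w) ∈ [w, 0]` holds for
all `z ∈ [-ℓ_m^ε, 0]` if and only if `Φ_m'(0) |w| ≥ 1`. -/
def IsDampingBound (m : ℕ) (εbar : ℝ) : Prop :=
  0 < εbar ∧ ∀ ε : ℝ, 0 ≤ ε → ε ≤ εbar → ∀ w : ℝ, w ≤ 0 →
    ((∀ z ∈ Set.Icc (-stabLength m ε) 0, Phi m ε z * (z + w) ∈ Set.Icc w 0) ↔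
      1 ≤ deriv (Phi m ε) 0 * |w|)

end

end MRKC

namespace MRKC

open Polynomial Polynomial.Chebyshev

/-! Write `a = Φ_m'(0)` and `P = Φ_m(z)`. Since `|T_s| ≤ T_s(ω₀)` on `[-ω₀, ω₀]`, stability only
requires `τ Φ_m(ηλ)(λ+ζ) ∈ [-ℓ_s, 0]`. If `a η|ζ| ≥ 1`, the inclusion with `w = ηζ` bounds this
argument below by `τζ`. Otherwise the borderline `w = -1/a` bounds it below by `-τ/(ηa)`. The
condition on `η` then suffices because `a ≥ (m²-1)/(6m²)` for every damping
(`sq_sub_one_mul_chebT'_sq_le`).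

For existence, the inclusion for all `|w| ≥ 1/a` follows from `P (1 - a z) ≤ 1`. Both factors are
known to first order at `0`, so `1 - P (1 - a z)` has a double zero there. Dividing by `z²` leaves,
up to a positive factor, a polynomial continuous in `(ω₀, ω₁z)`, namely `contactQuotient`. Without
damping `P` is a normalised Fejér kernel, and `sin_nat_mul_sq_lt` makes the quotient strictly
positive away from `0`; its value at `0` is computed directly. Compactness extends positivity to
small damping. -/

/-! ### Chebyshev polynomials on `[1, ∞)`. -/

lemma iterate_derivative_T_eval_one_nonneg (n k : ℕ) :
    0 ≤ (derivative^[k] (T ℝ (n : ℤ))).eval 1 := by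
  induction k with
  | zero => simp
  | succ k ih =>
    rcases le_or_gt k n with hk | hk
    · have h := iterate_derivative_T_eval_one_recurrence (R := ℝ) (n : ℤ) k
      have hkn : (k : ℝ) ≤ n := by exact_mod_cast hk
      have h2 : (0 : ℝ) ≤ (n : ℝ) ^ 2 - (k : ℝ) ^ 2 := by nlinarith [Nat.cast_nonneg (α := ℝ) k]
      have h3 : (0 : ℝ) < 2 * (k : ℝ) + 1 := by positivity
      refine nonneg_of_mul_nonneg_right ?_ h3
      rw [h]
      exact mul_nonneg (by simpa using h2) ih
    · rw [iterate_derivative_eq_zero (by simp; omega)]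
      simp

/-- The Taylor coefficients at `1` are nonnegative, being multiples of higher derivatives of `T_n`
at `1`. -/
lemma monotoneOn_iterate_derivative_T (n k : ℕ) :
    MonotoneOn (fun x : ℝ => (derivative^[k] (T ℝ (n : ℤ))).eval x) (Set.Ici 1) := by
  intro x hx y hy hxy
  rw [Set.mem_Ici] at hx hy
  set p := derivative^[k] (T ℝ (n : ℤ)) with hp
  have hc : ∀ i, 0 ≤ (taylor 1 p).coeff i := by
    intro i
    have h1 : ((Nat.factorial i : ℕ) : ℝ) * (taylor 1 p).coeff i
        = (derivative^[i + k] (T ℝ (n : ℤ))).eval 1 := by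
      rw [taylor_coeff, Function.iterate_add_apply, ← hp, ← factorial_smul_hasseDeriv]
      simp
    refine nonneg_of_mul_nonneg_right ?_ (show (0 : ℝ) < (Nat.factorial i : ℕ) by positivity)
    rw [h1]
    exact iterate_derivative_T_eval_one_nonneg n (i + k)
  have he : ∀ t : ℝ, p.eval t = (taylor 1 p).eval (t - 1) := by
    intro t; rw [taylor_eval]; simp
  simp only [he, eval_eq_sum_range]
  refine Finset.sum_le_sum fun i _ => mul_le_mul_of_nonneg_left ?_ (hc i)
  exact pow_le_pow_left₀ (by linarith) (by linarith) i

lemma iterate_derivative_T_eval_nonneg (n k : ℕ) {x : ℝ} (hx : 1 ≤ x) :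
    0 ≤ (derivative^[k] (T ℝ (n : ℤ))).eval x :=
  (iterate_derivative_T_eval_one_nonneg n k).trans
    (monotoneOn_iterate_derivative_T n k (Set.mem_Ici.2 le_rfl) (Set.mem_Ici.2 hx) hx)

lemma chebT_pos (n : ℕ) {x : ℝ} (hx : 1 ≤ x) : 0 < chebT n x :=
  lt_of_lt_of_le one_pos (one_le_eval_T_real n hx)

lemma chebT'_pos {n : ℕ} (hn : 1 ≤ n) {x : ℝ} (hx : 1 ≤ x) : 0 < chebT' n x := by
  have h := monotoneOn_iterate_derivative_T n 1 (Set.mem_Ici.2 le_rfl) (Set.mem_Ici.2 hx) hx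
  simp only [Function.iterate_one, derivative_T_eval_one] at h
  have : (0 : ℝ) < n := by exact_mod_cast hn
  refine lt_of_lt_of_le ?_ h
  push_cast
  positivity

lemma abs_chebT_le {n : ℕ} {x ω : ℝ} (hω : 1 ≤ ω) (hx : |x| ≤ ω) :
    |chebT n x| ≤ chebT n ω := by
  rcases le_or_gt |x| 1 with h | h
  · exact (abs_eval_T_real_le_one n h).trans (one_le_eval_T_real n hω)
  · have h1 : |chebT n x| = |chebT n (abs x)| := by
      rcases abs_choice x with h2 | h2 <;> rw [h2]
      rw [chebT, chebT, T_eval_neg, abs_mul]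
      rcases Int.units_eq_one_or (Int.negOnePow (n : ℤ)) with h3 | h3 <;> simp [h3]
    rw [h1, abs_of_pos (chebT_pos n h.le)]
    exact monotoneOn_iterate_derivative_T n 0 (Set.mem_Ici.2 h.le) (Set.mem_Ici.2 hω) hx

/-- Equality holds at `1`. The difference of the two sides has derivative `(n²+2) T'T'' + 3n² T
T'''`, which is nonnegative on `[1, ∞)`. -/
lemma sq_sub_one_mul_chebT'_sq_le (n : ℕ) {x : ℝ} (hx : 1 ≤ x) :
    ((n : ℝ) ^ 2 - 1) * chebT' n x ^ 2
      ≤ 3 * (n : ℝ) ^ 2 * (chebT n x * (derivative^[2] (T ℝ (n : ℤ))).eval x) := by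
  set G : ℝ → ℝ := fun x => 3 * (n : ℝ) ^ 2 * (chebT n x * (derivative^[2] (T ℝ (n : ℤ))).eval x)
    - ((n : ℝ) ^ 2 - 1) * chebT' n x ^ 2 with hG
  have hd : ∀ t : ℝ, HasDerivAt G (3 * (n : ℝ) ^ 2 * (chebT' n t *
      (derivative^[2] (T ℝ (n : ℤ))).eval t + chebT n t * (derivative^[3] (T ℝ (n : ℤ))).eval t)
      - ((n : ℝ) ^ 2 - 1) * (2 * chebT' n t * (derivative^[2] (T ℝ (n : ℤ))).eval t)) t := by
    intro t
    have e0 : HasDerivAt (chebT n) (chebT' n t) t := (T ℝ (n : ℤ)).hasDerivAt t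
    have e1 : HasDerivAt (chebT' n) ((derivative^[2] (T ℝ (n : ℤ))).eval t) t :=
      (derivative (T ℝ (n : ℤ))).hasDerivAt t
    have e2 : HasDerivAt (fun x => (derivative^[2] (T ℝ (n : ℤ))).eval x)
        ((derivative^[3] (T ℝ (n : ℤ))).eval t) t := (derivative^[2] (T ℝ (n : ℤ))).hasDerivAt t
    have := ((e0.mul e2).const_mul (3 * (n : ℝ) ^ 2)).sub ((e1.pow 2).const_mul ((n : ℝ) ^ 2 - 1))
    refine this.congr_deriv ?_
    simp
  have hmono : MonotoneOn G (Set.Ici 1) := by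
    refine monotoneOn_of_deriv_nonneg (convex_Ici 1)
      (fun t _ => (hd t).continuousAt.continuousWithinAt)
      (fun t _ => (hd t).differentiableAt.differentiableWithinAt) fun t ht => ?_
    rw [interior_Ici, Set.mem_Ioi] at ht
    rw [(hd t).deriv]
    have a0 : 0 ≤ chebT n t := (chebT_pos n ht.le).le
    have a1 : 0 ≤ chebT' n t := iterate_derivative_T_eval_nonneg n 1 ht.le
    have a2 := iterate_derivative_T_eval_nonneg n 2 ht.le
    have a3 := iterate_derivative_T_eval_nonneg n 3 ht.le
    have b1 := mul_nonneg a1 a2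
    have b2 := mul_nonneg a0 a3
    have b3 : 0 ≤ (n : ℝ) ^ 2 := by positivity
    nlinarith [mul_nonneg b3 b1, mul_nonneg b3 b2]
  have h1 : G 1 = 0 := by
    have r := iterate_derivative_T_eval_one_recurrence (R := ℝ) (n : ℤ) 1
    have r1 : chebT' n 1 = (n : ℝ) ^ 2 := by
      rw [chebT', derivative_T_eval_one]; simp
    have r0 : chebT n 1 = 1 := T_eval_one (R := ℝ) _
    have r2 : (derivative^[1] (T ℝ (n : ℤ))).eval 1 = (n : ℝ) ^ 2 := r1
    rw [r2] at r
    norm_num at r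
    simp only [hG, r0, r1]
    rw [show derivative^[2] (T ℝ (n : ℤ)) = derivative (derivative (T ℝ (n : ℤ))) from rfl]
    linear_combination (n : ℝ) ^ 2 * r
  have := hmono (Set.mem_Ici.2 le_rfl) (Set.mem_Ici.2 hx) hx
  rw [h1] at this
  simp only [hG] at this
  linarith

/-! ### A strict bound on the Fejér kernel. -/

/-- This expression is the sign-determining factor of the derivative in
`strictMonoOn_sq_div_sin_sq_sub`. -/
lemma sin_sub_mul_cos_sub_pos {x : ℝ} (h0 : 0 < x) (hx : x ≤ Real.pi) :
    0 < Real.sin x - x * Real.cos x - Real.sin x ^ 3 / 3 := by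
  set K : ℝ → ℝ := fun x => Real.sin x - x * Real.cos x - Real.sin x ^ 3 / 3 with hK
  have hd : ∀ t, HasDerivAt K (Real.sin t * (t - Real.sin t * Real.cos t)) t := by
    intro t
    have := ((Real.hasDerivAt_sin t).sub ((hasDerivAt_id t).mul (Real.hasDerivAt_cos t))).sub
      (((Real.hasDerivAt_sin t).pow 3).div_const 3)
    refine this.congr_deriv ?_
    simp
    ring
  have hm : StrictMonoOn K (Set.Icc 0 Real.pi) := by
    refine strictMonoOn_of_deriv_pos (convex_Icc _ _)
      (fun t _ => (hd t).continuousAt.continuousWithinAt) fun t ht => ?_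
    rw [interior_Icc] at ht
    rw [(hd t).deriv]
    refine mul_pos (Real.sin_pos_of_pos_of_lt_pi ht.1 ht.2) ?_
    have h1 := Real.sin_lt ht.1
    nlinarith [Real.sin_pos_of_pos_of_lt_pi ht.1 ht.2, Real.cos_le_one t]
  have := hm (Set.left_mem_Icc.2 (h0.le.trans hx)) ⟨h0.le, hx⟩ h0
  simpa [hK] using this

lemma strictMonoOn_sq_div_sin_sq_sub :
    StrictMonoOn (fun x : ℝ => x ^ 2 / Real.sin x ^ 2 - x ^ 2 / 3) (Set.Ioo 0 Real.pi) := by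
  have hd : ∀ t ∈ Set.Ioo 0 Real.pi, HasDerivAt (fun x : ℝ => x ^ 2 / Real.sin x ^ 2 - x ^ 2 / 3)
      (2 * t / Real.sin t ^ 3 * (Real.sin t - t * Real.cos t - Real.sin t ^ 3 / 3)) t := by
    intro t ht
    have hs := (Real.sin_pos_of_pos_of_lt_pi ht.1 ht.2).ne'
    have := ((hasDerivAt_pow 2 t).div ((Real.hasDerivAt_sin t).pow 2) (pow_ne_zero 2 hs)).sub
      ((hasDerivAt_pow 2 t).div_const 3)
    refine this.congr_deriv ?_
    simp
    field_simp
  refine strictMonoOn_of_deriv_pos (convex_Ioo _ _)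
    (fun t ht => (hd t ht).continuousAt.continuousWithinAt) fun t ht => ?_
  rw [interior_Ioo] at ht
  rw [(hd t ht).deriv]
  have hs := Real.sin_pos_of_pos_of_lt_pi ht.1 ht.2
  have ht0 := ht.1
  have := sin_sub_mul_cos_sub_pos ht.1 ht.2.le
  positivity

/-- The Fejér kernel lies strictly below a rational function of `sin² φ`. -/
lemma sin_nat_mul_sq_lt {m : ℕ} (hm : 2 ≤ m) {φ : ℝ} (h0 : 0 < φ) (hφ : φ ≤ Real.pi / 2) :
    Real.sin (m * φ) ^ 2 * (1 + ((m : ℝ) ^ 2 - 1) / 3 * Real.sin φ ^ 2)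
      < (m : ℝ) ^ 2 * Real.sin φ ^ 2 := by
  have hm' : (2 : ℝ) ≤ m := by exact_mod_cast hm
  have hpi := Real.pi_pos
  have hs : 0 < Real.sin φ := Real.sin_pos_of_pos_of_lt_pi h0 (by linarith)
  rcases lt_or_ge ((m : ℝ) * φ) Real.pi with h | h
  -- Below `π`, the bound is the monotonicity of `x²/sin² x - x²/3` between `φ` and `mφ`.
  · have hmφ : 0 < (m : ℝ) * φ := by positivity
    have hS : 0 < Real.sin (m * φ) := Real.sin_pos_of_pos_of_lt_pi hmφ h
    have key := strictMonoOn_sq_div_sin_sq_sub (show φ ∈ Set.Ioo 0 Real.pi from ⟨h0, by linarith⟩)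
      (show (m : ℝ) * φ ∈ Set.Ioo 0 Real.pi from ⟨hmφ, h⟩) (by nlinarith)
    simp only at key
    have e : (m * φ) ^ 2 / Real.sin (m * φ) ^ 2 - (m * φ) ^ 2 / 3
        - (φ ^ 2 / Real.sin φ ^ 2 - φ ^ 2 / 3)
        = φ ^ 2 / (Real.sin (m * φ) ^ 2 * Real.sin φ ^ 2) * ((m : ℝ) ^ 2 * Real.sin φ ^ 2 -
          Real.sin (m * φ) ^ 2 * (1 + ((m : ℝ) ^ 2 - 1) / 3 * Real.sin φ ^ 2)) := by
      field_simp
      ring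
    have h1 := sub_pos.2 key
    rw [e] at h1
    exact sub_pos.1 (pos_of_mul_pos_right h1 (by positivity))
  -- Beyond `π`, Jordan's inequality gives `m sin φ ≥ 2`, and `sin²(mφ) ≤ 1` is enough.
  · have hJ := Real.mul_le_sin h0.le hφ
    have h2 : 2 ≤ (m : ℝ) * Real.sin φ := by
      have : 2 / Real.pi * Real.pi ≤ m * (2 / Real.pi * φ) := by
        have : 2 / Real.pi * Real.pi ≤ 2 / Real.pi * (m * φ) := by gcongr
        linarith
      rw [div_mul_cancel₀ _ hpi.ne'] at this
      nlinarith
    have h3 : 4 ≤ (m : ℝ) ^ 2 * Real.sin φ ^ 2 := by nlinarith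
    have h4 := Real.sin_sq_le_one (m * φ)
    have h5 : 0 ≤ Real.sin φ ^ 2 := sq_nonneg _
    have h6 : 0 ≤ ((m : ℝ) ^ 2 - 1) / 3 * Real.sin φ ^ 2 := by
      have : 0 ≤ (m : ℝ) ^ 2 - 1 := by nlinarith
      positivity
    nlinarith

/-! ### Second order Taylor expansion of `T_n`. -/

/-- The `k`-th Taylor coefficient of `T_n` at `ω`. -/
noncomputable def chebCoeff (n k : ℕ) (ω : ℝ) : ℝ := (hasseDeriv k (T ℝ (n : ℤ))).eval ω

/-- The remainder of the second order Taylor expansion of `T_n` at `ω`, divided by `y ^ 3`. -/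
noncomputable def chebRem (n : ℕ) (ω y : ℝ) : ℝ :=
  ∑ k ∈ Finset.range n, chebCoeff n (k + 3) ω * y ^ k

lemma chebCoeff_one (n : ℕ) (ω : ℝ) : chebCoeff n 1 ω = chebT' n ω := by
  simp [chebCoeff, chebT', hasseDeriv_one]

lemma two_mul_chebCoeff_two (n : ℕ) (ω : ℝ) :
    2 * chebCoeff n 2 ω = (derivative^[2] (T ℝ (n : ℤ))).eval ω := by
  rw [← factorial_smul_hasseDeriv]
  simp [chebCoeff]

lemma six_mul_chebCoeff_three (n : ℕ) (ω : ℝ) :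
    6 * chebCoeff n 3 ω = (derivative^[3] (T ℝ (n : ℤ))).eval ω := by
  rw [← factorial_smul_hasseDeriv]
  simp [chebCoeff, Nat.factorial]

lemma continuous_chebCoeff (n k : ℕ) : Continuous (chebCoeff n k) :=
  (hasseDeriv k (T ℝ (n : ℤ))).continuous

lemma continuous_chebRem (n : ℕ) : Continuous fun p : ℝ × ℝ => chebRem n p.1 p.2 := by
  unfold chebRem
  refine continuous_finsetSum _ fun k _ => ?_
  exact ((continuous_chebCoeff n (k + 3)).comp continuous_fst).mul (continuous_snd.pow k)

lemma chebT_add (n : ℕ) (ω y : ℝ) :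
    chebT n (ω + y) = chebT n ω + chebT' n ω * y + chebCoeff n 2 ω * y ^ 2
      + chebRem n ω y * y ^ 3 := by
  have h : chebT n (ω + y) = (taylor ω (T ℝ (n : ℤ))).eval y := by
    rw [taylor_eval, chebT, add_comm]
  rw [h, eval_eq_sum_range' (n := n + 3) (by rw [natDegree_taylor]; simp),
    Finset.sum_range_succ', Finset.sum_range_succ', Finset.sum_range_succ', chebRem,
    Finset.sum_mul, ← chebCoeff_one]
  simp only [taylor_coeff, chebCoeff, chebT]
  simp only [hasseDeriv_zero', pow_zero, mul_one, zero_add, pow_one, add_assoc, Nat.reduceAdd,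
    mul_assoc, ← pow_add]
  ring

/-! ### The RKC stability polynomial and `Φ`. -/

lemma one_le_omega0 (s : ℕ) {ε : ℝ} (hε : 0 ≤ ε) : 1 ≤ omega0 s ε := by
  unfold omega0
  have : 0 ≤ ε / (s : ℝ) ^ 2 := by positivity
  linarith

section

variable {s : ℕ} {ε : ℝ}

lemma omega1_pos (hs : 1 ≤ s) (hε : 0 ≤ ε) : 0 < omega1 s ε :=
  div_pos (chebT_pos s (one_le_omega0 s hε)) (chebT'_pos hs (one_le_omega0 s hε))

lemma stabLength_pos (hs : 1 ≤ s) (hε : 0 ≤ ε) : 0 < stabLength s ε := by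
  have := one_le_omega0 s hε
  exact div_pos (by linarith) (omega1_pos hs hε)

lemma omega1_mul_stabLength (hs : 1 ≤ s) (hε : 0 ≤ ε) :
    omega1 s ε * stabLength s ε = 2 * omega0 s ε := by
  unfold stabLength
  exact mul_div_cancel₀ _ (omega1_pos hs hε).ne'

lemma abs_stabPoly_le_one (hs : 1 ≤ s) (hε : 0 ≤ ε) {z : ℝ}
    (hz : z ∈ Set.Icc (-stabLength s ε) 0) : |stabPoly s ε z| ≤ 1 := by
  have hω := one_le_omega0 s hε
  have h1 := omega1_pos hs hε
  have hT := chebT_pos s hω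
  have hl := omega1_mul_stabLength hs hε
  have hx : |omega0 s ε + omega1 s ε * z| ≤ omega0 s ε := by
    rw [abs_le]
    constructor <;> nlinarith [hz.1, hz.2]
  rw [stabPoly, coeffB, abs_mul, abs_of_pos (one_div_pos.2 hT), one_div_mul_eq_div, div_le_one hT]
  exact abs_chebT_le hω hx

lemma stabPoly_eq (hs : 1 ≤ s) (hε : 0 ≤ ε) (z : ℝ) :
    stabPoly s ε z = 1 + z * ((chebT' s (omega0 s ε) + chebCoeff s 2 (omega0 s ε) *
      (omega1 s ε * z) + chebRem s (omega0 s ε) (omega1 s ε * z) * (omega1 s ε * z) ^ 2)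
        / chebT' s (omega0 s ε)) := by
  have h0 := (chebT_pos s (one_le_omega0 s hε)).ne'
  have h1 := (chebT'_pos hs (one_le_omega0 s hε)).ne'
  rw [stabPoly, coeffB, chebT_add]
  have e : omega1 s ε = chebT s (omega0 s ε) / chebT' s (omega0 s ε) := rfl
  generalize chebRem s (omega0 s ε) (omega1 s ε * z) = B
  rw [e]
  field_simp
  ring

lemma Phi_eq (hs : 1 ≤ s) (hε : 0 ≤ ε) (z : ℝ) :
    Phi s ε z = (chebT' s (omega0 s ε) + chebCoeff s 2 (omega0 s ε) *
      (omega1 s ε * z) + chebRem s (omega0 s ε) (omega1 s ε * z) * (omega1 s ε * z) ^ 2)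
        / chebT' s (omega0 s ε) := by
  have h1 := (chebT'_pos hs (one_le_omega0 s hε)).ne'
  unfold Phi
  split_ifs with h
  · simp [h, h1]
  · rw [stabPoly_eq hs hε, add_sub_cancel_left, mul_div_cancel_left₀ _ h]

lemma stabPoly_eq_one_add_mul_Phi (hs : 1 ≤ s) (hε : 0 ≤ ε) (z : ℝ) :
    stabPoly s ε z = 1 + z * Phi s ε z := by
  rw [Phi_eq hs hε, stabPoly_eq hs hε]

lemma hasDerivAt_Phi_zero (hs : 1 ≤ s) (hε : 0 ≤ ε) :
    HasDerivAt (Phi s ε)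
      (chebCoeff s 2 (omega0 s ε) * omega1 s ε / chebT' s (omega0 s ε)) 0 := by
  set ω := omega0 s ε
  set ω₁ := omega1 s ε
  have hB : Differentiable ℝ fun z => chebRem s ω (ω₁ * z) := by
    unfold chebRem
    fun_prop
  have h1 : HasDerivAt (fun z : ℝ => ω₁ * z) ω₁ 0 := by
    simpa using (hasDerivAt_id (0 : ℝ)).const_mul ω₁
  have h2 := ((((h1.const_mul (chebCoeff s 2 ω)).const_add (chebT' s ω)).add
    ((hB 0).hasDerivAt.mul (h1.pow 2))).div_const (chebT' s ω))
  have h3 : Phi s ε = _ := funext (Phi_eq hs hε)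
  rw [h3]
  refine h2.congr_deriv ?_
  simp

lemma deriv_Phi_zero (hs : 1 ≤ s) (hε : 0 ≤ ε) :
    deriv (Phi s ε) 0 = chebCoeff s 2 (omega0 s ε) * omega1 s ε / chebT' s (omega0 s ε) :=
  (hasDerivAt_Phi_zero hs hε).deriv

lemma sq_sub_one_div_le_deriv_Phi_zero (hs : 1 ≤ s) (hε : 0 ≤ ε) :
    ((s : ℝ) ^ 2 - 1) / (6 * (s : ℝ) ^ 2) ≤ deriv (Phi s ε) 0 := by
  have hω := one_le_omega0 s hε
  have h1 := chebT'_pos hs hω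
  have h := sq_sub_one_mul_chebT'_sq_le s hω
  have hs' : (0 : ℝ) < s := by exact_mod_cast hs
  rw [← two_mul_chebCoeff_two] at h
  rw [deriv_Phi_zero hs hε, omega1, mul_div_assoc', div_div, div_le_div_iff₀ (by positivity)
    (by positivity)]
  linarith

lemma Phi_nonneg (hs : 1 ≤ s) (hε : 0 ≤ ε) {z : ℝ}
    (hz : z ∈ Set.Icc (-stabLength s ε) 0) : 0 ≤ Phi s ε z := by
  unfold Phi
  split_ifs with h
  · exact zero_le_one
  · have := (abs_le.1 (abs_stabPoly_le_one hs hε hz)).2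
    exact div_nonneg_of_nonpos (by linarith) hz.2

/-- For `z < 0` the lower inclusion reads `Φ(z) ≤ |w| (Φ(z) - 1)/z`; let `z → 0⁻`. No smallness of
the damping is needed. -/
lemma one_le_deriv_Phi_mul_of_forall_mem (hs : 1 ≤ s) (hε : 0 ≤ ε) {w : ℝ} (hw : w ≤ 0)
    (h : ∀ z ∈ Set.Icc (-stabLength s ε) 0, Phi s ε z * (z + w) ∈ Set.Icc w 0) :
    1 ≤ deriv (Phi s ε) 0 * |w| := by
  have hd := hasDerivAt_Phi_zero hs hε
  rw [← deriv_Phi_zero hs hε] at hd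
  have hP0 : Phi s ε 0 = 1 := by simp [Phi]
  have hslope := (hasDerivAt_iff_tendsto_slope.1 hd).mono_left
    (nhdsWithin_mono (0 : ℝ) (show Set.Iio (0 : ℝ) ⊆ {0}ᶜ from fun x hx => ne_of_lt hx))
  have hcont : Filter.Tendsto (Phi s ε) (nhdsWithin 0 (Set.Iio 0)) (nhds 1) := by
    rw [← hP0]
    exact hd.continuousAt.tendsto.mono_left nhdsWithin_le_nhds
  refine le_of_tendsto_of_tendsto hcont (hslope.mul_const |w|) ?_
  have hl := stabLength_pos hs hε
  have hmem : Set.Ioo (-stabLength s ε) 0 ∈ nhdsWithin (0 : ℝ) (Set.Iio 0) :=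
    Ioo_mem_nhdsLT (by linarith)
  filter_upwards [hmem] with z hz
  have h1 := (h z ⟨hz.1.le, hz.2.le⟩).1
  rw [slope_def_field, hP0, abs_of_nonpos hw, sub_zero, div_mul_eq_mul_div, le_div_iff_of_neg hz.2]
  linarith

/-- The lower inclusion is `|z| P ≤ |w| (1 - P)`. As `P ≤ 1`, the worst case is `|w| = 1/a`, which
is exactly `hk`. -/
lemma Phi_mul_add_mem (hs : 1 ≤ s) (hε : 0 ≤ ε)
    {z : ℝ} (hz : z ∈ Set.Icc (-stabLength s ε) 0)
    (hk : Phi s ε z * (1 - deriv (Phi s ε) 0 * z) ≤ 1) {w : ℝ} (hw : w ≤ 0)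
    (ha : 1 ≤ deriv (Phi s ε) 0 * |w|) : Phi s ε z * (z + w) ∈ Set.Icc w 0 := by
  have hP := Phi_nonneg hs hε hz
  rw [abs_of_nonpos hw] at ha
  set a := deriv (Phi s ε) 0
  set P := Phi s ε z
  have ha0 : 0 < a := by
    by_contra hcon
    nlinarith
  have hz0 := hz.2
  have hP1 : P ≤ 1 := by
    nlinarith [mul_nonneg hP (mul_nonneg ha0.le (neg_nonneg.2 hz0))]
  refine ⟨?_, mul_nonpos_of_nonneg_of_nonpos hP (by linarith)⟩
  have h1 : a * (w * (1 - P)) ≤ a * (z * P) := by nlinarith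
  have := le_of_mul_le_mul_left h1 ha0
  linarith

end

/-! ### Existence of an admissible damping bound. -/

/-- A positive multiple of `(1 - Phi z * (1 - Phi' 0 * z)) / h ^ 2`, where `h = - ω₁ z`. -/
noncomputable def contactQuotient (n : ℕ) (ω h : ℝ) : ℝ :=
  chebCoeff n 2 ω ^ 2 - chebRem n ω (-h) * (chebT' n ω + chebCoeff n 2 ω * h)

lemma continuous_contactQuotient (n : ℕ) :
    Continuous fun p : ℝ × ℝ => contactQuotient n p.1 p.2 := by
  have h1 : Continuous (chebT' n) := (derivative (T ℝ (n : ℤ))).continuous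
  have h2 := continuous_chebCoeff n 2
  have h3 : Continuous fun p : ℝ × ℝ => chebRem n p.1 (-p.2) :=
    (continuous_chebRem n).comp (continuous_fst.prodMk continuous_snd.neg)
  unfold contactQuotient
  fun_prop

lemma Phi_mul_one_sub_le {s : ℕ} {ε : ℝ} (hs : 1 ≤ s) (hε : 0 ≤ ε) {z : ℝ}
    (h : 0 ≤ contactQuotient s (omega0 s ε) (-(omega1 s ε * z))) :
    Phi s ε z * (1 - deriv (Phi s ε) 0 * z) ≤ 1 := by
  have h1 := chebT'_pos hs (one_le_omega0 s hε)
  rw [Phi_eq hs hε, deriv_Phi_zero hs hε]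
  unfold contactQuotient at h
  rw [neg_neg] at h
  generalize chebRem s (omega0 s ε) (omega1 s ε * z) = B at *
  generalize chebT' s (omega0 s ε) = c₁ at *
  generalize chebCoeff s 2 (omega0 s ε) = c₂ at *
  generalize omega1 s ε = ω₁ at *
  have e : 1 - c₂ * ω₁ / c₁ * z = (c₁ - c₂ * (ω₁ * z)) / c₁ := by field_simp
  rw [e, div_mul_div_comm, div_le_one (by positivity)]
  nlinarith [mul_nonneg (sq_nonneg (ω₁ * z)) h]

lemma chebT'_one (n : ℕ) : chebT' n 1 = (n : ℝ) ^ 2 := by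
  rw [chebT', derivative_T_eval_one]; simp

lemma chebCoeff_two_one (n : ℕ) : 6 * chebCoeff n 2 1 = (n : ℝ) ^ 2 * ((n : ℝ) ^ 2 - 1) := by
  have r := iterate_derivative_T_eval_one_recurrence (R := ℝ) (n : ℤ) 1
  rw [← two_mul_chebCoeff_two, show (derivative^[1] (T ℝ (n : ℤ))).eval 1 = (n : ℝ) ^ 2 from
    chebT'_one n] at r
  norm_num at r
  linarith

lemma chebCoeff_three_one (n : ℕ) :
    15 * chebCoeff n 3 1 = ((n : ℝ) ^ 2 - 4) * chebCoeff n 2 1 := by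
  have r := iterate_derivative_T_eval_one_recurrence (R := ℝ) (n : ℤ) 2
  rw [← two_mul_chebCoeff_two, ← six_mul_chebCoeff_three] at r
  norm_num at r
  linarith

lemma contactQuotient_one_pos {m : ℕ} (hm : 2 ≤ m) {h : ℝ} (h0 : 0 ≤ h) (h2 : h ≤ 2) :
    0 < contactQuotient m 1 h := by
  have hm' : (2 : ℝ) ≤ m := by exact_mod_cast hm
  have c2 := chebCoeff_two_one m
  have c1 := chebT'_one m
  have hm1 : 0 < (m : ℝ) ^ 2 - 1 := by nlinarith
  rcases h0.eq_or_lt with rfl | hpos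
  -- At `h = 0` the remainder is the third Taylor coefficient, so the sign comes from the explicit
  -- derivatives of `T_m` at `1`.
  · have c3 := chebCoeff_three_one m
    have hB : chebRem m 1 (-0) = chebCoeff m 3 1 := by
      obtain ⟨k, rfl⟩ : ∃ k, m = k + 1 := ⟨m - 1, by omega⟩
      rw [chebRem, Finset.sum_range_succ']
      simp
    rw [contactQuotient, hB, c1, mul_zero, add_zero]
    have hc : 0 < chebCoeff m 2 1 := by
      have : 0 < (m : ℝ) ^ 2 * ((m : ℝ) ^ 2 - 1) := by positivity
      linarith
    have e : chebCoeff m 2 1 ^ 2 - chebCoeff m 3 1 * (m : ℝ) ^ 2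
        = chebCoeff m 2 1 * ((m : ℝ) ^ 2 * ((m : ℝ) ^ 2 + 1) / 10) := by
      linear_combination chebCoeff m 2 1 / 6 * c2 - (m : ℝ) ^ 2 / 15 * c3
    rw [e]
    positivity
  -- With `1 - h = cos 2φ`, `T_m(1 - h) = cos 2mφ` and the Fejér kernel appears.
  · set φ := Real.arccos (1 - h) / 2 with hφ
    have hφ0 : 0 < φ := half_pos (Real.arccos_pos.2 (by linarith))
    have hφ1 : φ ≤ Real.pi / 2 := by have := Real.arccos_le_pi (1 - h); linarith
    have hcos : Real.cos (2 * φ) = 1 - h := by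
      rw [hφ, mul_div_cancel₀ _ two_ne_zero, Real.cos_arccos (by linarith) (by linarith)]
    have hsin : h = 2 * Real.sin φ ^ 2 := by
      rw [Real.cos_two_mul, Real.cos_sq'] at hcos; linarith
    have hT : chebT m (1 + -h) = 1 - 2 * Real.sin (m * φ) ^ 2 := by
      rw [← sub_eq_add_neg, ← hcos, chebT, T_real_cos]
      push_cast
      rw [mul_left_comm, Real.cos_two_mul, Real.cos_sq']
      ring
    have hadd := chebT_add m 1 (-h)
    rw [hT, c1, show chebT m 1 = 1 from T_eval_one (R := ℝ) _] at hadd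
    have key := sin_nat_mul_sq_lt hm hφ0 hφ1
    have e : contactQuotient m 1 h * h ^ 3 = 2 * (m : ℝ) ^ 2 * ((m : ℝ) ^ 2 * Real.sin φ ^ 2
        - Real.sin (m * φ) ^ 2 * (1 + ((m : ℝ) ^ 2 - 1) / 3 * Real.sin φ ^ 2)) := by
      rw [contactQuotient, c1]
      generalize chebRem m 1 (-h) = B at *
      have hs : Real.sin φ ^ 2 = h / 2 := by linarith
      rw [hs]
      have hc2 : chebCoeff m 2 1 = (m : ℝ) ^ 2 * ((m : ℝ) ^ 2 - 1) / 6 := by linarith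
      rw [hc2] at hadd ⊢
      linear_combination (-((m : ℝ) ^ 2 + (m : ℝ) ^ 2 * ((m : ℝ) ^ 2 - 1) / 6 * h)) * hadd
    have hpr : 0 < contactQuotient m 1 h * h ^ 3 := by
      rw [e]
      exact mul_pos (by positivity) (sub_pos.2 key)
    exact pos_of_mul_pos_left hpr (by positivity)

lemma exists_contactQuotient_pos {m : ℕ} (hm : 2 ≤ m) :
    ∃ δ > 0, ∀ ω, 1 ≤ ω → ω ≤ 1 + δ → ∀ h, 0 ≤ h → h ≤ 2 * ω → 0 < contactQuotient m ω h := by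
  -- Scaling `h = 2ωt` turns the moving interval `[0, 2ω]` into the fixed compact `[0, 1]`.
  have hc : Continuous fun p : ℝ × ℝ => contactQuotient m p.1 (2 * p.1 * p.2) :=
    (continuous_contactQuotient m).comp (by fun_prop : Continuous fun p : ℝ × ℝ =>
      (p.1, 2 * p.1 * p.2))
  have hev : ∀ᶠ ω in nhds (1 : ℝ), ∀ t ∈ Set.Icc (0 : ℝ) 1,
      0 < contactQuotient m ω (2 * ω * t) := by
    refine isCompact_Icc.eventually_forall_of_forall_eventually fun t ht => ?_
    exact hc.continuousAt.eventually (lt_mem_nhds (contactQuotient_one_pos hm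
      (by have := ht.1; positivity) (by have := ht.2; simp only; linarith)))
  obtain ⟨δ, hδ, hball⟩ := Metric.eventually_nhds_iff.1 hev
  refine ⟨δ / 2, by positivity, fun ω h1 h2 h h3 h4 => ?_⟩
  have hd : dist ω 1 < δ := by
    rw [Real.dist_eq, abs_of_nonneg (by linarith)]; linarith
  have := hball hd (h / (2 * ω))
    ⟨by positivity, (div_le_one (by linarith)).2 h4⟩
  rwa [mul_div_cancel₀ _ (by linarith)] at this

lemma exists_isDampingBound {m : ℕ} (hm : 2 ≤ m) : ∃ εbar, IsDampingBound m εbar := by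
  obtain ⟨δ, hδ, hq⟩ := exists_contactQuotient_pos hm
  have hm1 : 1 ≤ m := by omega
  have hm' : (0 : ℝ) < m := by exact_mod_cast hm1
  refine ⟨δ * (m : ℝ) ^ 2, by positivity, fun ε hε hεδ w hw =>
    ⟨one_le_deriv_Phi_mul_of_forall_mem hm1 hε hw, fun ha z hz => ?_⟩⟩
  refine Phi_mul_add_mem hm1 hε hz (Phi_mul_one_sub_le hm1 hε (hq _ (one_le_omega0 m hε) ?_ _
    ?_ ?_).le) hw ha
  · unfold omega0
    have := (div_le_iff₀ (by positivity)).2 hεδ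
    linarith
  · have := omega1_pos hm1 hε
    nlinarith [hz.2]
  · have := omega1_pos hm1 hε
    rw [← omega1_mul_stabLength hm1 hε]
    nlinarith [hz.1]

/-! ### The scheme applied to the test equation. -/

lemma chebT_add_two (j : ℕ) (x : ℝ) :
    chebT (j + 2) x = 2 * x * chebT (j + 1) x - chebT j x := by
  simp only [chebT]
  push_cast
  rw [T_add_two]
  simp

lemma chebT'_add_two (j : ℕ) (x : ℝ) :
    chebT' (j + 2) x = 2 * chebT (j + 1) x + 2 * x * chebT' (j + 1) x - chebT' j x := by
  simp only [chebT, chebT']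
  push_cast
  rw [T_add_two]
  simp [derivative_mul]

section

variable {s : ℕ} {ε : ℝ}

lemma rkcStage_linear (hε : 0 ≤ ε) (τ μ y : ℝ) (j : ℕ) :
    rkcStage s ε τ (fun u => μ * u) y j
      = coeffB s ε j * chebT j (omega0 s ε + omega1 s ε * (τ * μ)) * y := by
  have hω := one_le_omega0 s hε
  have hω0 : omega0 s ε ≠ 0 := by linarith
  induction j using Nat.twoStepInduction with
  | zero => simp [rkcStage, coeffB, chebT]
  | one =>
    simp only [rkcStage, coeffB, chebT]
    simp
    field_simp
  | more j ih0 ih1 =>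
    have h0 := (chebT_pos j hω).ne'
    have h1 := (chebT_pos (j + 1) hω).ne'
    have h2 := (chebT_pos (j + 2) hω).ne'
    simp only [rkcStage, ih0, ih1, coeffB, chebT_add_two j (omega0 s ε + omega1 s ε * (τ * μ))]
    field_simp
    ring

/-- Translating by the equilibrium `-d` removes the constant force: the stage weights are consistent
by the recurrence of `T_j` at `ω₀`. -/
lemma rkcStage_shift (hε : 0 ≤ ε) (τ μ c d y : ℝ) (hd : μ * d = c) (j : ℕ) :
    rkcStage s ε τ (fun u => μ * u + c) y j
      = rkcStage s ε τ (fun u => μ * u) (y + d) j - d := by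
  have hω := one_le_omega0 s hε
  induction j using Nat.twoStepInduction with
  | zero => simp [rkcStage]
  | one => simp only [rkcStage]; rw [← hd]; ring
  | more j ih0 ih1 =>
    have h0 := (chebT_pos j hω).ne'
    have h1 := (chebT_pos (j + 1) hω).ne'
    have h2 := (chebT_pos (j + 2) hω).ne'
    have hr := chebT_add_two j (omega0 s ε)
    simp only [rkcStage, ih0, ih1, coeffB]
    rw [← hd]
    generalize rkcStage s ε τ (fun u => μ * u) (y + d) j = u
    generalize rkcStage s ε τ (fun u => μ * u) (y + d) (j + 1) = v
    field_simp
    rw [hr]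
    ring

/-- Covers `μ = 0`, where there is no equilibrium to shift to. The stages follow the differentiated
Chebyshev recurrence. -/
lemma rkcStage_const (hε : 0 ≤ ε) (τ c y : ℝ) (j : ℕ) :
    rkcStage s ε τ (fun _ => c) y j
      = y + omega1 s ε * coeffB s ε j * chebT' j (omega0 s ε) * (τ * c) := by
  have hω := one_le_omega0 s hε
  have hω0 : omega0 s ε ≠ 0 := by linarith
  induction j using Nat.twoStepInduction with
  | zero => simp [rkcStage, chebT']
  | one => simp [rkcStage, coeffB, chebT, chebT']; ring
  | more j ih0 ih1 =>
    have h0 := (chebT_pos j hω).ne'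
    have h1 := (chebT_pos (j + 1) hω).ne'
    have h2 := (chebT_pos (j + 2) hω).ne'
    have hr := chebT_add_two j (omega0 s ε)
    simp only [rkcStage, ih0, ih1, coeffB, chebT'_add_two]
    field_simp
    rw [hr]
    ring

lemma rkcStep_linear (hε : 0 ≤ ε) (τ μ y : ℝ) :
    rkcStep s ε τ (fun u => μ * u) y = stabPoly s ε (τ * μ) * y :=
  rkcStage_linear hε τ μ y s

lemma rkcStep_affine (hs : 1 ≤ s) (hε : 0 ≤ ε) (τ μ c y : ℝ) :
    rkcStep s ε τ (fun u => μ * u + c) y = y + τ * Phi s ε (τ * μ) * (μ * y + c) := by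
  rcases eq_or_ne μ 0 with rfl | hμ
  · have h0 := (chebT_pos s (one_le_omega0 s hε)).ne'
    have h1 := (chebT'_pos hs (one_le_omega0 s hε)).ne'
    simp only [zero_mul, zero_add, mul_zero]
    rw [rkcStep, rkcStage_const hε, coeffB, omega1]
    simp only [Phi, if_true]
    field_simp
  · rw [rkcStep, rkcStage_shift hε τ μ c (c / μ) y (mul_div_cancel₀ c hμ), ← rkcStep,
      rkcStep_linear hε, stabPoly_eq_one_add_mul_Phi hs hε]
    field_simp
    ring

lemma mrkcStep_linear {m : ℕ} {ε' : ℝ} (hm : 1 ≤ m) (hε : 0 ≤ ε) (hε' : 0 ≤ ε') {η : ℝ}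
    (hη : η ≠ 0) (τ lam ζ y : ℝ) :
    mrkcStep s m ε ε' τ η (fun x => lam * x) (fun x => ζ * x) y
      = mrkcStabPoly s m ε ε' lam ζ τ η * y := by
  have h : averagedForce m ε' η (fun x => lam * x) (fun x => ζ * x)
      = fun y => (Phi m ε' (η * lam) * (lam + ζ)) * y := by
    funext y
    rw [averagedForce, rkcStep_affine hm hε']
    field_simp
    ring
  rw [mrkcStep, h, rkcStep_linear hε, mrkcStabPoly, mul_assoc τ]

end

/-! ### Stability of the multirate scheme. -/

lemma abs_mrkcStabPoly_le_one {m : ℕ} (hm : 2 ≤ m) {εbar : ℝ} (hb : IsDampingBound m εbar)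
    {ε ε' lam ζ : ℝ} (hε : 0 ≤ ε) (hε' : 0 ≤ ε') (hle : ε' ≤ εbar) (hlam : lam ≤ 0) (hζ : ζ < 0)
    {s : ℕ} {τ η : ℝ} (hs : 1 ≤ s) (hτ : 0 < τ) (hη : 0 < η)
    (h1 : τ * |ζ| ≤ stabLength s ε) (h2 : η * |lam| ≤ stabLength m ε')
    (h3 : 6 * τ / stabLength s ε * ((m : ℝ) ^ 2 / ((m : ℝ) ^ 2 - 1)) ≤ η) :
    |mrkcStabPoly s m ε ε' lam ζ τ η| ≤ 1 := by
  have hm1 : 1 ≤ m := by omega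
  have hm' : (2 : ℝ) ≤ m := by exact_mod_cast hm
  have hmm : 0 < (m : ℝ) ^ 2 - 1 := by nlinarith
  have hl := stabLength_pos hs hε
  have hk := sq_sub_one_div_le_deriv_Phi_zero hm1 hε'
  have hb' := hb.2 ε' hε' hle
  rw [abs_of_neg hζ] at h1
  rw [abs_of_nonpos hlam] at h2
  have hz : η * lam ∈ Set.Icc (-stabLength m ε') 0 :=
    ⟨by linarith, mul_nonpos_of_nonneg_of_nonpos hη.le hlam⟩
  have hP := Phi_nonneg hm1 hε' hz
  set a := deriv (Phi m ε') 0
  set P := Phi m ε' (η * lam)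
  have ha : 0 < a := lt_of_lt_of_le (by positivity) hk
  refine abs_stabPoly_le_one hs hε ⟨?_, ?_⟩
  · rcases le_or_gt 1 (a * |η * ζ|) with hc | hc
    · have h := ((hb' (η * ζ) (by nlinarith)).2 hc _ hz).1
      have h' : ζ ≤ P * (lam + ζ) := by
        have : η * ζ ≤ η * (P * (lam + ζ)) := by linarith
        exact le_of_mul_le_mul_left this hη
      nlinarith
    -- Here `ηζ` is too small for the inclusion, so it is replaced by the smallest permitted size `w
    -- = -1/a ≤ ηζ`. This only lowers the bound, since `P ≥ 0`.
    · have hc' : a * |-(1 / a)| = 1 := by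
        rw [abs_neg, abs_of_pos (by positivity), mul_one_div_cancel ha.ne']
      have h := ((hb' (-(1 / a)) (neg_nonpos.2 (by positivity))).2 hc'.ge _ hz).1
      have hw : -(1 / a) ≤ η * ζ := by
        rw [abs_of_nonpos (by nlinarith)] at hc
        rw [neg_le, le_div_iff₀ ha]
        linarith
      have h' : -(1 / a) ≤ η * (P * (lam + ζ)) := by
        have := mul_le_mul_of_nonneg_left hw hP
        linarith
      have hτη : τ ≤ stabLength s ε * η * a := by
        have e1 : τ ≤ stabLength s ε * η * (((m : ℝ) ^ 2 - 1) / (6 * (m : ℝ) ^ 2)) := by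
          rw [div_mul_div_comm, div_le_iff₀ (by positivity)] at h3
          rw [mul_div_assoc', le_div_iff₀ (by positivity)]
          linarith
        exact e1.trans (by gcongr)
      have h4 : τ * (1 / a) ≤ stabLength s ε * η := by
        rw [mul_one_div, div_le_iff₀ ha]
        exact hτη
      have h5 : η * (-stabLength s ε) ≤ η * (τ * P * (lam + ζ)) := by
        have := mul_le_mul_of_nonneg_left h' hτ.le
        linarith
      exact le_of_mul_le_mul_left h5 hη
  · exact mul_nonpos_of_nonneg_of_nonpos (mul_nonneg hτ.le hP) (by linarith)

end MRKC


theorem mainTheorem1 (m : ℕ) (hm : 2 ≤ m) :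
    (∃ εbar : ℝ, MRKC.IsDampingBound m εbar) ∧
    ∀ εbar : ℝ, MRKC.IsDampingBound m εbar →
      ∀ (ε lam ζ : ℝ), 0 ≤ ε → lam ≤ 0 → ζ < 0 →
      ∀ (s : ℕ) (τ η : ℝ), 1 ≤ s → 0 < τ →
        τ * |ζ| ≤ MRKC.stabLength s ε →
        η * |lam| ≤ MRKC.stabLength m (min ε εbar) →
        6 * τ / MRKC.stabLength s ε * ((m : ℝ) ^ 2 / ((m : ℝ) ^ 2 - 1)) ≤ η →
        |MRKC.mrkcStabPoly s m ε (min ε εbar) lam ζ τ η| ≤ 1 ∧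
        ∀ y : ℝ, |MRKC.mrkcStep s m ε (min ε εbar) τ η
          (fun x => lam * x) (fun x => ζ * x) y| ≤ |y| := by
  refine ⟨MRKC.exists_isDampingBound hm, ?_⟩
  intro εbar hb ε lam ζ hε hlam hζ s τ η hs hτ h1 h2 h3
  have hε' : 0 ≤ min ε εbar := le_min hε hb.1.le
  have hη : 0 < η := by
    have hm' : (2 : ℝ) ≤ m := by exact_mod_cast hm
    have hmm : 0 < (m : ℝ) ^ 2 - 1 := by nlinarith
    have hl := MRKC.stabLength_pos hs hε
    exact lt_of_lt_of_le (by positivity) h3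
  have hR := MRKC.abs_mrkcStabPoly_le_one hm hb hε hε' (min_le_right _ _) hlam hζ hs hτ hη h1 h2 h3
  refine ⟨hR, fun y => ?_⟩
  rw [MRKC.mrkcStep_linear (by omega) hε hε' hη.ne', abs_mul]
  exact mul_le_of_le_one_left (abs_nonneg y) hR
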